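/- Let $k$ be a commutative Artinian ring and let $A$ be an Artin $k$-algebra, i.e. a unital associative $k$-algebra that is finitely generated as a $k$-module. Let $A\text{-mod}$ be the category of finitely generated left $A$-modules. For $U\in A\text{-mod}$ let $\mathrm{add}(U)$ be the class of direct summands of finite direct sums of copies of $U$. For $M\in A\text{-mod}$ put $\Omega^0(M)=M$, and let $\Omega^{n+1}(M)$ be the kernel of a projective cover of $\Omega^{n}(M)$. For integers $m,n\ge 0$, $A$ is called an $(m,n)$-Igusa–Todorov algebra if there is $U\in A\text{-mod}$ such that for every $X\in A\text{-mod}$ there is an exact sequence $$0\to U_m\to U_{m-1}\to\cdots\to U_1\to U_0\to\Omega^n(X)\to 0$$ with $U_i\in\mathrm{add}(U)$ for all $0\le i\le m$. Let $$\mathrm{IT.dist}(A)=\inf\{m\ge 0 : A\text{ is an }(m,n)\text{-Igusa–Todorov algebra for some } n\ge 0\}\in\mathbb{N}\cup\{\infty\}.$$ Let $\mathscr{D}_{\mathrm{sg}}(A)=\mathscr{D}^b(A\text{-mod})/\mathrm{perf}(A)$ be the Verdier quotient, where $\mathrm{perf}(A)$ is the full subcategory of complexes that are isomorphic in $\mathscr{D}^b(A\text{-mod})$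 to bounded complexes of finitely generated projective modules. For a triangulated category $\mathcal{T}$ let $\dim\mathcal{T}\in\mathbb{N}\cup\{\infty\}$ be the least $d\ge 0$ such that $\mathcal{T}=\langle M\rangle_{d+1}$ for some object $M$ (and $\infty$ if there is none), where $\langle M\rangle_{1}$ consists of the direct summands of finite direct sums of shifts of $M$, and $\langle M\rangle_{i+1}$ ($i\ge 1$) consists of the direct summands of objects $Y$ that fit into a distinguished triangle $Y_1\to Y\to Y_2\to Y_1[1]$ with $Y_1\in\langle M\rangle_{i}$ and $Y_2\in\langle M\rangle_{1}$. Then $$\dim(\mathscr{D}_{\mathrm{sg}}(A))\le \mathrm{IT.dist}(A).$$ -/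

import Mathlib

open CategoryTheory Limits Pretriangulated
open scoped ZeroObject

universe w u

/-! ### Artin algebras and finitely generated modules -/

/-- A ring which is module-finite over a commutative Artinian ring is Noetherian. -/
theorem isNoetherianRing_of_artinAlgebra (k : Type w) (A : Type u) [CommRing k]
    [IsArtinianRing k] [Ring A] [Algebra k A] [Module.Finite k A] : IsNoetherianRing A :=
  IsNoetherianRing.of_finite k A

section FGModule

variable (A : Type u) [Ring A]

instance : (ModuleCat.isFG.{u} A).IsClosedUnderIsomorphisms where
  of_iso e h := by
    rw [ModuleCat.isFG_iff] at h ⊢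
    exact Module.Finite.equiv e.toLinearEquiv

instance : (ModuleCat.isFG.{u} A).IsClosedUnderCokernels where
  cokernels_le := by
    rintro _ ⟨f, c, hc, hf⟩
    have h := hf.2
    rw [ModuleCat.isFG_iff] at h ⊢
    have := Cofork.IsColimit.epi hc
    exact Module.Finite.of_surjective c.π.hom ((ModuleCat.epi_iff_surjective _).1 inferInstance)

instance [IsNoetherianRing A] : (ModuleCat.isFG.{u} A).IsClosedUnderKernels where
  kernels_le := by
    rintro _ ⟨f, c, hc, hf⟩
    have h := hf.1
    rw [ModuleCat.isFG_iff] at h ⊢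
    have := Fork.IsLimit.mono hc
    exact Module.Finite.of_injective c.ι.hom ((ModuleCat.mono_iff_injective _).1 inferInstance)

instance : (ModuleCat.isFG.{u} A).ContainsZero where
  exists_zero := ⟨ModuleCat.of A PUnit, ModuleCat.isZero_of_subsingleton _, by
    rw [ModuleCat.isFG_iff]; infer_instance⟩

/-- The category `A-mod` of finitely generated left modules over a Noetherian ring is abelian. -/
noncomputable instance fgModuleCatAbelian [IsNoetherianRing A] : Abelian (FGModuleCat.{u} A) :=
  inferInstance

end FGModule

section Syzygy

variable (A : Type u) [Ring A]

/-- `f : P → M` is a projective cover: `P` is projective, `f` is surjective, and the kernel of `f`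
is a superfluous submodule of `P`. -/
structure IsProjectiveCover {A : Type u} [Ring A] {P M : FGModuleCat.{u} A} (f : P →ₗ[A] M) :
    Prop where
  projective : Module.Projective A P
  surjective : Function.Surjective f
  superfluous : ∀ N : Submodule A P, N ⊔ LinearMap.ker f = ⊤ → N = ⊤

/-- `IsSyzygy A n M K` says that `K` is (isomorphic to) the `n`-th syzygy `Ωⁿ(M)`, where
`Ω⁰(M) = M` and `Ωⁿ⁺¹(M)` is the kernel of a projective cover of `Ωⁿ(M)`. (Over an Artin algebra
projective covers exist and are unique up to isomorphism, so that `K` exists and is unique up to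
isomorphism.) -/
def IsSyzygy : ℕ → FGModuleCat.{u} A → FGModuleCat.{u} A → Prop
  | 0, M, K => Nonempty (K ≃ₗ[A] M)
  | n + 1, M, K => ∃ (L P : FGModuleCat.{u} A) (f : P →ₗ[A] L),
      IsSyzygy n M L ∧ IsProjectiveCover f ∧ Nonempty (K ≃ₗ[A] LinearMap.ker f)

/-- `IsInAdd A U M` says that `M` lies in `add(U)`: it is a direct summand of a finite direct sum
of copies of `U`. -/
def IsInAdd (U M : FGModuleCat.{u} A) : Prop :=
  ∃ (n : ℕ) (i : M →ₗ[A] (Fin n → U)) (r : (Fin n → U) →ₗ[A] M), r ∘ₗ i = LinearMap.id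

/-- There is an exact sequence `0 → V_m → ⋯ → V_1 → V_0 → X → 0` with all `V_i` in `add(U)`.
The sequence is written with terms indexed by all natural numbers, those of index `> m` being
zero; exactness at `V_m` then says that `V_m → V_{m-1}` (or `V_0 → X`) is injective. -/
def HasAddResolution (U : FGModuleCat.{u} A) (m : ℕ) (X : FGModuleCat.{u} A) : Prop :=
  ∃ (V : ℕ → FGModuleCat.{u} A) (d : ∀ i, V (i + 1) →ₗ[A] V i) (ε : V 0 →ₗ[A] X),
    (∀ i ≤ m, IsInAdd A U (V i)) ∧ (∀ i, m < i → Subsingleton (V i)) ∧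
      Function.Surjective ε ∧ Function.Exact (d 0) ε ∧
        ∀ i, Function.Exact (d (i + 1)) (d i)

/-- `A` is an `(m, n)`-Igusa–Todorov algebra: there is a finitely generated module `U` such that
for every finitely generated module `X` there is an exact sequence
`0 → U_m → ⋯ → U_1 → U_0 → Ωⁿ(X) → 0` with all `U_i` in `add(U)`. -/
def IsIgusaTodorov (m n : ℕ) : Prop :=
  ∃ U : FGModuleCat.{u} A, ∀ X : FGModuleCat.{u} A,
    ∃ K : FGModuleCat.{u} A, IsSyzygy A n X K ∧ HasAddResolution A U m K

/-- The Igusa–Todorov distance of `A`: the infimum of all `m` such that `A` is an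
`(m, n)`-Igusa–Todorov algebra for some `n` (and `⊤` if there is no such `m`). -/
noncomputable def igusaTodorovDist : ℕ∞ :=
  sInf {d : ℕ∞ | ∃ m n : ℕ, IsIgusaTodorov A m n ∧ d = m}

end Syzygy

/-! ### The dimension of a triangulated category -/

section Dimension

variable (T : Type*) [Category* T] [HasZeroObject T] [HasShift T ℤ] [Preadditive T]
  [∀ n : ℤ, (shiftFunctor T n).Additive] [Pretriangulated T]

/-- The dimension (in the sense of Rouquier) of a triangulated category `T`: the least `d` such
that `T = ⟨M⟩_{d+1}` for some object `M`, and `⊤` if there is none. Here `⟨M⟩_{d+1}`, consisting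
of the objects obtained from `M` by shifts, finite direct sums, direct summands and at most `d`
extensions, is Mathlib's `triangEnvelopeIter d`. -/
noncomputable def rouquierDim : ℕ∞ :=
  sInf {e : ℕ∞ | ∃ d : ℕ, (∃ M : T, (ObjectProperty.singleton M).triangEnvelopeIter d = ⊤) ∧ e = d}

end Dimension

/-! ### The singularity category -/

section Singularity

/-- A cochain complex of finitely generated modules is a bounded complex of (finitely generated)
projective modules. -/
def IsBoundedProjective (A : Type u) [Ring A] (K : CochainComplex (FGModuleCat.{u} A) ℤ) : Prop :=
  (∃ a : ℤ, K.IsStrictlyGE a) ∧ (∃ b : ℤ, K.IsStrictlyLE b) ∧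
    ∀ i : ℤ, Module.Projective A (K.X i)

theorem IsBoundedProjective.shift {A : Type u} [Ring A]
    {K : CochainComplex (FGModuleCat.{u} A) ℤ}
    (hK : IsBoundedProjective A K) (n : ℤ) : IsBoundedProjective A (K⟦n⟧) := by
  obtain ⟨⟨a, ha⟩, ⟨b, hb⟩, hP⟩ := hK
  exact ⟨⟨a - n, K.isStrictlyGE_shift a n _ (by lia)⟩,
    ⟨b - n, K.isStrictlyLE_shift b n _ (by lia)⟩, fun i => hP (i + n)⟩

variable (A : Type u) [Ring A] [IsNoetherianRing A]

/-- The standard construction of the derived category of `A-mod`. -/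
noncomputable instance fgModuleCatHasDerivedCategory :
    HasDerivedCategory.{u + 1} (FGModuleCat.{u} A) :=
  HasDerivedCategory.standard _

/-- The bounded derived category `D^b(A-mod)` of finitely generated modules. -/
abbrev BoundedDerived : Type (u + 1) := DerivedCategory.Bounded (FGModuleCat.{u} A)

/-- The objects of the derived category of `A-mod` which are isomorphic to bounded complexes of
finitely generated projective modules. -/
def perfectComplexes : ObjectProperty (DerivedCategory (FGModuleCat.{u} A)) :=
  fun X => ∃ K : CochainComplex (FGModuleCat.{u} A) ℤ, IsBoundedProjective A K ∧
    Nonempty (X ≅ DerivedCategory.Q.obj K)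

/-- The full subcategory `perf(A)` of `D^b(A-mod)`. -/
def perf : ObjectProperty (BoundedDerived A) :=
  (perfectComplexes A).inverseImage DerivedCategory.Bounded.ι

variable {A}

theorem fgModule_projective (P : FGModuleCat.{u} A) (hP : Module.Projective A P) :
    Projective P where
  factors {E X} f e he := by
    have he' : Epi ((forget₂ (FGModuleCat.{u} A) (ModuleCat.{u} A)).map e) := inferInstance
    have hs : Function.Surjective e.hom.hom := (ModuleCat.epi_iff_surjective _).1 he'
    obtain ⟨g, hg⟩ := Module.projective_lifting_property e.hom.hom f.hom.hom hs
    exact ⟨ObjectProperty.homMk (ModuleCat.ofHom g), FGModuleCat.hom_ext hg⟩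

theorem IsBoundedProjective.isKProjective {K : CochainComplex (FGModuleCat.{u} A) ℤ}
    (hK : IsBoundedProjective A K) : K.IsKProjective := by
  obtain ⟨-, ⟨b, hb⟩, hP⟩ := hK
  have := fun i => fgModule_projective _ (hP i)
  exact CochainComplex.isKProjective_of_projective K b

theorem IsBoundedProjective.mappingCone {K L : CochainComplex (FGModuleCat.{u} A) ℤ}
    (hK : IsBoundedProjective A K) (hL : IsBoundedProjective A L) (φ : K ⟶ L) :
    IsBoundedProjective A (CochainComplex.mappingCone φ) := by
  obtain ⟨⟨a, ha⟩, ⟨b, hb⟩, hP⟩ := hK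
  obtain ⟨⟨a', ha'⟩, ⟨b', hb'⟩, hP'⟩ := hL
  refine ⟨⟨min (a - 1) a', ?_⟩, ⟨max b b', ?_⟩, fun i => ?_⟩
  · rw [CochainComplex.isStrictlyGE_iff]
    intro i hi
    rw [CochainComplex.mappingCone.isZero_X_iff]
    exact ⟨K.isZero_of_isStrictlyGE a _ (by lia), L.isZero_of_isStrictlyGE a' _ (by lia)⟩
  · rw [CochainComplex.isStrictlyLE_iff]
    intro i hi
    rw [CochainComplex.mappingCone.isZero_X_iff]
    exact ⟨K.isZero_of_isStrictlyLE b _ (by lia), L.isZero_of_isStrictlyLE b' _ (by lia)⟩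
  · have := hP (i + 1)
    have := hP' i
    let s : ((CochainComplex.mappingCone φ).X i) →ₗ[A] (K.X (i + 1)) × (L.X i) :=
      LinearMap.prod ((CochainComplex.mappingCone.fst φ).1.v i (i + 1) rfl).hom.hom
        ((CochainComplex.mappingCone.snd φ).v i i (add_zero i)).hom.hom
    let r : (K.X (i + 1)) × (L.X i) →ₗ[A] ((CochainComplex.mappingCone φ).X i) :=
      LinearMap.coprod ((CochainComplex.mappingCone.inl φ).v (i + 1) i (by lia)).hom.hom
        ((CochainComplex.mappingCone.inr φ).f i).hom.hom
    refine Module.Projective.of_split s r ?_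
    have h := CochainComplex.mappingCone.id_X φ i (i + 1) rfl
    ext x
    exact (congrArg (fun g => g.hom.hom x) h :)

instance : (perfectComplexes A).IsClosedUnderIsomorphisms where
  of_iso := by
    rintro X Y e ⟨K, hK, ⟨e'⟩⟩
    exact ⟨K, hK, ⟨e.symm ≪≫ e'⟩⟩

instance : (perfectComplexes A).ContainsZero where
  exists_zero := by
    refine ⟨0, isZero_zero _, 0, ⟨⟨0, ?_⟩, ⟨0, ?_⟩, fun i => ?_⟩, ⟨?_⟩⟩
    · rw [CochainComplex.isStrictlyGE_iff]
      intro i _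
      exact (HomologicalComplex.eval _ _ i).map_isZero (isZero_zero _)
    · rw [CochainComplex.isStrictlyLE_iff]
      intro i _
      exact (HomologicalComplex.eval _ _ i).map_isZero (isZero_zero _)
    · have h : IsZero ((0 : CochainComplex (FGModuleCat.{u} A) ℤ).X i) :=
        (HomologicalComplex.eval _ _ i).map_isZero (isZero_zero _)
      have h' := (forget₂ (FGModuleCat.{u} A) (ModuleCat.{u} A)).map_isZero h
      have : Subsingleton ((0 : CochainComplex (FGModuleCat.{u} A) ℤ).X i) :=
        ModuleCat.subsingleton_of_isZero h'
      infer_instance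
    · exact (isZero_zero _).iso (DerivedCategory.Q.map_isZero (isZero_zero _))

instance : (perfectComplexes A).IsStableUnderShift ℤ where
  isStableUnderShiftBy n :=
    { le_shift := by
        rintro X ⟨K, hK, ⟨e⟩⟩
        exact ⟨K⟦n⟧, hK.shift n, ⟨(shiftFunctor _ n).mapIso e ≪≫
          (DerivedCategory.Q.commShiftIso n).symm.app K⟩⟩ }

theorem perfectComplexes_obj₃ (T : Triangle (DerivedCategory (FGModuleCat.{u} A)))
    (hT : T ∈ distTriang _) (h₁ : perfectComplexes A T.obj₁) (h₂ : perfectComplexes A T.obj₂) :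
    perfectComplexes A T.obj₃ := by
  obtain ⟨K, hK, ⟨e₁⟩⟩ := h₁
  obtain ⟨L, hL, ⟨e₂⟩⟩ := h₂
  have := hK.isKProjective
  obtain ⟨g, hg⟩ := (CochainComplex.IsKProjective.Qh_map_bijective K
    ((HomotopyCategory.quotient _ _).obj L)).surjective
      ((DerivedCategory.quotientCompQhIso _).hom.app K ≫ e₁.inv ≫ T.mor₁ ≫ e₂.hom ≫
        (DerivedCategory.quotientCompQhIso _).inv.app L)
  obtain ⟨φ, rfl⟩ := (HomotopyCategory.quotient _ _).map_surjective g
  have hφ : e₁.inv ≫ T.mor₁ ≫ e₂.hom = DerivedCategory.Q.map φ := by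
    have := (DerivedCategory.quotientCompQhIso (FGModuleCat.{u} A)).hom.naturality φ
    rw [← cancel_epi ((DerivedCategory.quotientCompQhIso _).hom.app K), ← this]
    dsimp
    rw [hg]
    simp
  have hφ' : e₁.hom ≫ DerivedCategory.Q.map φ = T.mor₁ ≫ e₂.hom := by
    rw [← hφ, Iso.hom_inv_id_assoc]
  have hT' := DerivedCategory.mappingCone_triangle_distinguished φ
  obtain ⟨e, -⟩ := exists_iso_of_arrow_iso _ _ hT hT'
    (Arrow.isoMk e₁ e₂ hφ')
  exact ⟨_, hK.mappingCone hL φ, ⟨Triangle.π₃.mapIso e⟩⟩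

instance : (perfectComplexes A).IsTriangulated where
  ext₂' _ hT h₁ h₃ := ObjectProperty.le_isoClosure _ _
    (perfectComplexes_obj₃ _ (inv_rot_of_distTriang _ hT)
      ((perfectComplexes A).le_shift (-1) _ h₃) h₁)

instance : (perf A).IsTriangulated := by
  unfold perf
  infer_instance

variable (A)

/-- The singularity category `D_sg(A) = D^b(A-mod) / perf(A)`: the Verdier quotient, that is, the
localization of `D^b(A-mod)` at the morphisms whose cone is in `perf(A)`, with the triangles
isomorphic to images of distinguished triangles of `D^b(A-mod)`. -/
abbrev SingularityCategory : Type (u + 1) := (perf A).trW.Localization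

end Singularity

/-! In the singularity category projective modules vanish, so `0 → ΩM → P → M → 0` gives `M ≅
ΩM[1]`: up to shift, a module and its syzygies are the same object
(`singularitySingle_of_isSyzygy`). Moreover every object is a shift of a module: mapping a
projective onto the top cohomology of a bounded complex and passing to the cone narrows the complex
without changing it in the quotient, until one degree is left
(`eq_top_of_forall_singularitySingle`).

It therefore suffices to build each `Ωⁿ(X)` from `U`. Cutting `0 → U_m → ⋯ → U_0 → Ωⁿ(X) → 0` into
short exact sequences, hence triangles, builds it from the `m + 1` objects `U_i` by `m` extensions
(`triangEnvelopeIter_of_hasAddResolution`). Thus the image of the single module `U` generates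
everything in `m` steps. -/

namespace CategoryTheory.ObjectProperty

/-! ### Retracts and finite sums. -/

section Retracts

variable {C : Type*} [Category* C] [HasBinaryProducts C]

instance (P : ObjectProperty C) [P.IsClosedUnderBinaryProducts] :
    P.retractClosure.IsClosedUnderBinaryProducts where
  limitsOfShape_le := by
    rintro X ⟨p⟩
    obtain ⟨Y, hY, ⟨r⟩⟩ := p.prop_diag_obj ⟨.left⟩
    obtain ⟨Z, hZ, ⟨s⟩⟩ := p.prop_diag_obj ⟨.right⟩
    refine P.retractClosure.prop_of_iso
      (X := p.diag.obj ⟨.left⟩ ⨯ p.diag.obj ⟨.right⟩) ?_ ?_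
    · exact IsLimit.conePointUniqueUpToIso (prodIsProd _ _)
        ((IsLimit.postcomposeHomEquiv (diagramIsoPair p.diag) _).2 p.isLimit)
    · exact ⟨Y ⨯ Z, P.prop_prod _ _ hY hZ,
        ⟨prod.map r.i s.i, prod.map r.r s.r, by simp [prod.map_map]⟩⟩

end Retracts

section Preadditive

variable {C : Type*} [Category* C] [Preadditive C] [HasZeroObject C] [HasFiniteProducts C]

/-- An object whose identity is a finite sum of maps factoring through `Y` belongs to every class
containing `Y` that is closed under retracts and binary products. -/
theorem prop_of_sum_comp_eq_id (P : ObjectProperty C) [P.IsClosedUnderBinaryProducts]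
    [P.IsStableUnderRetracts] {X Y : C} (hY : P Y) {n : ℕ} (a : Fin n → (X ⟶ Y))
    (b : Fin n → (Y ⟶ X)) (hab : ∑ j, a j ≫ b j = 𝟙 X) : P X := by
  have : P.Nonempty := ⟨Y, hY⟩
  have : P.IsClosedUnderFiniteProducts := .mk'
  have : HasFiniteBiproducts C := .of_hasFiniteProducts
  have hB : P (⨁ fun _ : Fin n => Y) :=
    P.prop_of_iso (biproduct.isoProduct _).symm (P.prop_product fun _ => hY)
  exact P.prop_of_retract ⟨biproduct.lift a, biproduct.desc b, by rw [biproduct.lift_desc, hab]⟩ hB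

end Preadditive

end CategoryTheory.ObjectProperty

/-! ### Exact sequences and projectives in `A-mod`. -/

namespace FGModuleCat

variable {A : Type u} [Ring A] [IsNoetherianRing A]

theorem epi_of_surjective {X Y : FGModuleCat.{u} A} (f : X ⟶ Y)
    (hf : Function.Surjective f.hom.hom) : Epi f :=
  (forget₂ (FGModuleCat.{u} A) (ModuleCat.{u} A)).epi_of_epi_map
    ((ModuleCat.epi_iff_surjective _).2 hf)

theorem shortExact_of_function_exact {X Y Z : FGModuleCat.{u} A} (f : X →ₗ[A] Y) (g : Y →ₗ[A] Z)
    (hf : Function.Injective f) (hg : Function.Surjective g) (h : Function.Exact f g) :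
    ∃ (i : X ⟶ Y) (p : Y ⟶ Z) (w : i ≫ p = 0), (ShortComplex.mk i p w).ShortExact := by
  let S : ShortComplex (FGModuleCat.{u} A) :=
    ShortComplex.mk (ObjectProperty.homMk (ModuleCat.ofHom f) : X ⟶ Y)
      (ObjectProperty.homMk (ModuleCat.ofHom g) : Y ⟶ Z)
      (FGModuleCat.hom_ext h.linearMap_comp_eq_zero)
  refine ⟨S.f, S.g, S.zero, ?_⟩
  apply CategoryTheory.ShortExact.reflects_shortExact_of_faithful
    (forget₂ (FGModuleCat.{u} A) (ModuleCat.{u} A))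
  exact
    { exact := (ShortComplex.ShortExact.moduleCat_exact_iff_function_exact _).2 h
      mono_f := (ModuleCat.mono_iff_injective _).2 hf
      epi_g := (ModuleCat.epi_iff_surjective _).2 hg }

theorem exists_projective_surjective (M : FGModuleCat.{u} A) :
    ∃ (P : FGModuleCat.{u} A) (f : P ⟶ M), Module.Projective A P ∧ Epi f := by
  obtain ⟨n, f, hf⟩ := Module.Finite.exists_fin' A M
  exact ⟨FGModuleCat.of A (Fin n → A), ObjectProperty.homMk (ModuleCat.ofHom f),
    inferInstanceAs (Module.Projective A (Fin n → A)), epi_of_surjective _ hf⟩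

end FGModuleCat

/-! ### Removing the top cohomology with a projective. -/

section Reduction

variable {C : Type*} [Category* C] [Abelian C]

/-- A morphism of cochain complexes that is an epimorphism in a degree where both differentials
leaving that degree vanish induces an epimorphism on homology in that degree. -/
theorem CochainComplex.epi_homologyMap_of_d_eq_zero {K L : CochainComplex C ℤ} (φ : K ⟶ L) (b : ℤ)
    (hK : K.d b (b + 1) = 0) (hL : L.d b (b + 1) = 0) [Epi (φ.f b)] :
    Epi (HomologicalComplex.homologyMap φ b) := by
  have := K.isIso_iCycles b (b + 1) (by simp) hK
  have := L.isIso_iCycles b (b + 1) (by simp) hL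
  have h : HomologicalComplex.cyclesMap φ b = K.iCycles b ≫ φ.f b ≫ inv (L.iCycles b) := by
    simp [← cancel_mono (L.iCycles b)]
  have : Epi (HomologicalComplex.cyclesMap φ b) := by
    rw [h]
    infer_instance
  have : Epi (K.homologyπ b ≫ HomologicalComplex.homologyMap φ b) := by
    rw [HomologicalComplex.homologyπ_naturality]
    infer_instance
  exact epi_of_epi (K.homologyπ b) _

end Reduction

section

variable {A : Type u} [Ring A] [IsNoetherianRing A]

theorem perfectComplexes_singleFunctor (P : FGModuleCat.{u} A) [Module.Projective A P] (n : ℤ) :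
    perfectComplexes A ((DerivedCategory.singleFunctor _ n).obj P) := by
  refine ⟨(HomologicalComplex.single _ (ComplexShape.up ℤ) n).obj P,
    ⟨⟨n, inferInstance⟩, ⟨n, inferInstance⟩, fun i => ?_⟩,
    ⟨(DerivedCategory.singleFunctorIsoCompQ _ n).app P⟩⟩
  by_cases hi : i = n
  · subst hi
    have e := HomologicalComplex.singleObjXSelf (ComplexShape.up ℤ) i P
    exact Module.Projective.of_equiv (FGModuleCat.isoToLinearEquiv e.symm)
  · have h := (forget₂ (FGModuleCat.{u} A) (ModuleCat.{u} A)).map_isZero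
      (HomologicalComplex.isZero_single_obj_X (ComplexShape.up ℤ) n P i hi)
    have : Subsingleton
        (((HomologicalComplex.single _ (ComplexShape.up ℤ) n).obj P).X i) :=
      ModuleCat.subsingleton_of_isZero h
    infer_instance

open DerivedCategory in
/-- Every object with cohomology in `[a, b + 1]` has a map from a projective module placed in
degree `b + 1` whose cone has cohomology in `[a, b]`. -/
theorem exists_triangle_single_projective (X : DerivedCategory (FGModuleCat.{u} A)) (a b : ℤ)
    (hab : a ≤ b) [X.IsGE a] [X.IsLE (b + 1)] :
    ∃ (P : FGModuleCat.{u} A) (_ : Module.Projective A P)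
      (Z : DerivedCategory (FGModuleCat.{u} A)) (m : (singleFunctor _ (b + 1)).obj P ⟶ X)
      (g : X ⟶ Z) (h : Z ⟶ ((singleFunctor _ (b + 1)).obj P)⟦(1 : ℤ)⟧),
      Triangle.mk m g h ∈ distTriang _ ∧ Z.IsGE a ∧ Z.IsLE b := by
  obtain ⟨K, _, _, ⟨e⟩⟩ := exists_iso_Q_obj_of_isGE_of_isLE X a (b + 1)
  obtain ⟨P, f, hP, hf⟩ := FGModuleCat.exists_projective_surjective (K.X (b + 1))
  -- No nonzero differential leaves the top degree of `K`, so `f` alone is a map of complexes.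
  let φ : (HomologicalComplex.single _ (ComplexShape.up ℤ) (b + 1)).obj P ⟶ K :=
    HomologicalComplex.mkHomFromSingle f (by
      rintro k rfl
      exact (K.isZero_of_isStrictlyLE (b + 1) _ (by lia)).eq_of_tgt _ _)
  have : Epi (φ.f (b + 1)) := by
    dsimp only [φ]
    rw [HomologicalComplex.mkHomFromSingle_f]
    infer_instance
  have hφ := CochainComplex.epi_homologyMap_of_d_eq_zero φ (b + 1) (by simp)
    ((K.isZero_of_isStrictlyLE (b + 1) _ (by lia)).eq_of_tgt _ _)
  have hQ : Epi ((homologyFunctor _ (b + 1)).map (Q.map φ)) :=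
    ((MorphismProperty.epimorphisms _).arrow_mk_iso_iff
      (((Functor.mapArrowFunctor _ _).mapIso (homologyFunctorFactors _ (b + 1))).app
        (Arrow.mk φ))).2 hφ
  let m : (singleFunctor _ (b + 1)).obj P ⟶ X :=
    (singleFunctorIsoCompQ _ (b + 1)).hom.app P ≫ Q.map φ ≫ e.inv
  have hm : Epi ((homologyFunctor _ (b + 1)).map m) := by
    have : Epi ((homologyFunctor _ (b + 1)).map (Q.map φ ≫ e.inv)) := by
      rw [Functor.map_comp]
      infer_instance
    rw [Functor.map_comp]
    exact epi_comp' inferInstance this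
  obtain ⟨Z, g, h, hT⟩ := distinguished_cocone_triangle m
  refine ⟨P, hP, Z, m, g, h, hT, ?_, ?_⟩
  -- For `i < a`, the bound `a ≤ b` gives `i + 1 < b + 1`, so `P` contributes nothing to `Hⁱ` of the
  -- cone.
  · refine (isGE_iff _ _).2 fun i hi => ?_
    exact (HomologySequence.exact₃ _ hT i (i + 1)).isZero_of_both_zeros
      ((X.isZero_of_isGE a i hi).eq_of_src _ _)
      ((isZero_of_isGE ((singleFunctor _ (b + 1)).obj P) (b + 1) (i + 1) (by lia)).eq_of_tgt _ _)
  · refine (isLE_iff _ _).2 fun i hi => ?_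
    refine (HomologySequence.exact₃ _ hT i (i + 1)).isZero_of_both_zeros ?_
      ((isZero_of_isLE ((singleFunctor _ (b + 1)).obj P) (b + 1) (i + 1) (by lia)).eq_of_tgt _ _)
    -- Only in degree `b + 1` can `X` have cohomology to kill; there surjectivity of `m` is needed.
    obtain rfl | hi' := eq_or_ne i (b + 1)
    · exact (HomologySequence.epi_homologyMap_mor₁_iff _ hT _).1 hm
    · exact (X.isZero_of_isLE (b + 1) i (by lia)).eq_of_src _ _

end

/-! ### Triangles in a triangulated subcategory. -/

namespace CategoryTheory.ObjectProperty

variable {C : Type*} [Category* C] [HasZeroObject C] [HasShift C ℤ] [Preadditive C]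
  [∀ n : ℤ, (shiftFunctor C n).Additive] [Pretriangulated C]

/-- A distinguished triangle whose vertices lie in a triangulated subcategory lifts to a
distinguished triangle in that subcategory. -/
theorem exists_distTriang_fullSubcategory (P : ObjectProperty C) [P.IsTriangulated]
    {X Y Z : P.FullSubcategory} (f : X.obj ⟶ Y.obj) (g : Y.obj ⟶ Z.obj)
    (h : Z.obj ⟶ X.obj⟦(1 : ℤ)⟧) (hT : Triangle.mk f g h ∈ distTriang C) :
    ∃ h' : Z ⟶ X⟦(1 : ℤ)⟧,
      Triangle.mk (homMk f : X ⟶ Y) (homMk g : Y ⟶ Z) h' ∈ distTriang P.FullSubcategory := by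
  -- The shifts of the subcategory and of `C` are compared through `commShiftIso`, so `h` is
  -- corrected by it before being lifted.
  have hcomp : (h ≫ (P.ι.commShiftIso (1 : ℤ)).inv.app X) ≫
      (P.ι.commShiftIso (1 : ℤ)).hom.app X = h := by
    rw [Category.assoc, Iso.inv_hom_id_app]
    exact Category.comp_id h
  exact ⟨P.fullyFaithfulι.preimage (h ≫ (P.ι.commShiftIso (1 : ℤ)).inv.app X),
    isomorphic_distinguished _ hT _
      (Triangle.isoMk _ _ (Iso.refl _) (Iso.refl _) (Iso.refl _)
        ((Category.comp_id _).trans (Category.id_comp _).symm)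
        ((Category.comp_id _).trans (Category.id_comp _).symm)
        ((congrArg₂ (fun a b => a ≫ b) hcomp ((shiftFunctor C (1 : ℤ)).map_id X.obj)).trans
          ((Category.comp_id h).trans (Category.id_comp h).symm)))⟩

end CategoryTheory.ObjectProperty

/-! ### Modules and syzygies in the singularity category. -/

section SingularityCategory

open DerivedCategory

variable (A : Type u) [Ring A] [IsNoetherianRing A]

/-- The Verdier quotient functor `D^b(A-mod) ⥤ D_sg(A)`. -/
noncomputable abbrev singularityQuotient : BoundedDerived A ⥤ SingularityCategory A :=
  (perf A).trW.Q

/-- The functor sending a module to the complex concentrated in degree `n`. -/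
noncomputable abbrev boundedSingle (n : ℤ) : FGModuleCat.{u} A ⥤ BoundedDerived A :=
  ObjectProperty.lift _ (singleFunctor (FGModuleCat.{u} A) n)
    fun _ => ⟨⟨n, inferInstance⟩, ⟨n, inferInstance⟩⟩

instance (n : ℤ) : (boundedSingle A n).Additive where
  map_add {_ _ f g} := by
    ext
    exact (singleFunctor (FGModuleCat.{u} A) n).map_add

/-- The functor sending a module to the corresponding object of the singularity category. -/
noncomputable abbrev singularitySingle : FGModuleCat.{u} A ⥤ SingularityCategory A :=
  boundedSingle A 0 ⋙ singularityQuotient A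

variable {A}

/-- The cone of `X ⟶ 0` is `X⟦1⟧`, which is perfect, so the quotient inverts this map. -/
theorem isZero_singularityQuotient_obj {X : BoundedDerived A} (hX : perf A X) :
    IsZero ((singularityQuotient A).obj X) := by
  have h : (perf A).trW (0 : X ⟶ 0) :=
    .mk _ (rot_of_distTriang _ (contractible_distinguished X)) ((perf A).le_shift 1 _ hX)
  have := Localization.inverts (singularityQuotient A) _ _ h
  exact ((singularityQuotient A).map_isZero (isZero_zero _)).of_iso
    (asIso ((singularityQuotient A).map (0 : X ⟶ 0)))

theorem exists_distTriang_singularityQuotient {X Y Z : BoundedDerived A} (f : X.obj ⟶ Y.obj)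
    (g : Y.obj ⟶ Z.obj) (h : Z.obj ⟶ X.obj⟦(1 : ℤ)⟧) (hT : Triangle.mk f g h ∈ distTriang _) :
    ∃ (f' : (singularityQuotient A).obj X ⟶ (singularityQuotient A).obj Y)
      (g' : (singularityQuotient A).obj Y ⟶ (singularityQuotient A).obj Z)
      (h' : (singularityQuotient A).obj Z ⟶ ((singularityQuotient A).obj X)⟦(1 : ℤ)⟧),
      Triangle.mk f' g' h' ∈ distTriang (SingularityCategory A) := by
  obtain ⟨_, hT'⟩ := ObjectProperty.exists_distTriang_fullSubcategory _ f g h hT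
  exact ⟨_, _, _, (singularityQuotient A).map_distinguished _ hT'⟩

/-- A short exact sequence of modules yields a distinguished triangle in the singularity
category. -/
theorem exists_distTriang_singularitySingle {X Y Z : FGModuleCat.{u} A} (f : X →ₗ[A] Y)
    (g : Y →ₗ[A] Z) (hf : Function.Injective f) (hg : Function.Surjective g)
    (h : Function.Exact f g) :
    ∃ (f' : (singularitySingle A).obj X ⟶ (singularitySingle A).obj Y)
      (g' : (singularitySingle A).obj Y ⟶ (singularitySingle A).obj Z)
      (h' : (singularitySingle A).obj Z ⟶ ((singularitySingle A).obj X)⟦(1 : ℤ)⟧),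
      Triangle.mk f' g' h' ∈ distTriang (SingularityCategory A) := by
  obtain ⟨i, p, w, hS⟩ := FGModuleCat.shortExact_of_function_exact f g hf hg h
  exact exists_distTriang_singularityQuotient (X := (boundedSingle A 0).obj X)
    (Y := (boundedSingle A 0).obj Y) (Z := (boundedSingle A 0).obj Z) _ _ _
    hS.singleTriangle_distinguished

theorem isZero_singularitySingle_obj (P : FGModuleCat.{u} A) [Module.Projective A P] :
    IsZero ((singularitySingle A).obj P) :=
  isZero_singularityQuotient_obj (perfectComplexes_singleFunctor P 0)

/-- A class of objects of the singularity category that is closed under isomorphisms and shifts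
contains a module as soon as it contains one of its syzygies. -/
theorem singularitySingle_of_isSyzygy (Q : ObjectProperty (SingularityCategory A))
    [Q.IsClosedUnderIsomorphisms] [Q.IsStableUnderShift ℤ] {n : ℕ} {M K : FGModuleCat.{u} A}
    (hK : IsSyzygy A n M K) (hQ : Q ((singularitySingle A).obj K)) :
    Q ((singularitySingle A).obj M) := by
  induction n generalizing K with
  | zero =>
    obtain ⟨e⟩ := hK
    exact Q.prop_of_iso ((singularitySingle A).mapIso e.toFGModuleCatIso) hQ
  | succ n ih =>
    obtain ⟨L, P, f, hL, hf, ⟨e⟩⟩ := hK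
    have := hf.projective
    obtain ⟨f', g', h', hT⟩ := exists_distTriang_singularitySingle
      ((LinearMap.ker f).subtype ∘ₗ e.toLinearMap) f
      ((Submodule.injective_subtype _).comp e.injective) hf.surjective (by
        intro x
        constructor
        · intro hx
          exact ⟨e.symm ⟨x, hx⟩, by simp⟩
        · rintro ⟨y, rfl⟩
          exact (e y).2)
    -- The projective middle term vanishes, so the connecting map identifies `L` with `K⟦1⟧`.
    have : IsIso h' := (Triangle.isZero₂_iff_isIso₃ _ hT).1 (isZero_singularitySingle_obj P)
    exact ih hL (Q.prop_of_iso (asIso h').symm (Q.le_shift 1 _ hQ))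

/-- Induction on the cohomological width: each step replaces `X` by the cone of a map from a shifted
projective, isomorphic to `X` in the quotient. What remains is a module in degree `a`, which a shift
moves to degree `0`. -/
theorem singularityQuotient_of_isGE_of_isLE (Q : ObjectProperty (SingularityCategory A))
    [Q.IsClosedUnderIsomorphisms] [Q.IsStableUnderShift ℤ]
    (hQ : ∀ M, Q ((singularitySingle A).obj M)) (a : ℤ) (n : ℕ) :
    ∀ (X : BoundedDerived A), X.obj.IsGE a → X.obj.IsLE (a + n) →
      Q ((singularityQuotient A).obj X) := by
  induction n with
  | zero =>
    intro X _ hX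
    simp only [Nat.cast_zero, add_zero] at hX
    obtain ⟨M, ⟨e⟩⟩ := exists_iso_singleFunctor_obj_of_isGE_of_isLE X.obj a
    let e' : X⟦a⟧ ≅ (boundedSingle A 0).obj M := ObjectProperty.isoMk _
      ((Bounded.ι.commShiftIso a).app X ≪≫ (shiftFunctor _ a).mapIso e ≪≫
        ((singleFunctors _).shiftIso a 0 a (add_zero a)).app M)
    have h : Q (((singularityQuotient A).obj X)⟦a⟧) := Q.prop_of_iso
      ((singularityQuotient A).mapIso e'.symm ≪≫
        ((singularityQuotient A).commShiftIso a).app X) (hQ M)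
    exact (Q.prop_shift_iff_of_isStableUnderShift _ a).1 h
  | succ n ih =>
    intro X _ hX
    rw [Nat.cast_succ, ← add_assoc] at hX
    obtain ⟨P, hP, Z, m, g, h, hT, hZ₁, hZ₂⟩ :=
      exists_triangle_single_projective X.obj a (a + n) (by lia)
    obtain ⟨f', g', h', hT'⟩ := exists_distTriang_singularityQuotient
      (X := (boundedSingle A (a + n + 1)).obj P) (Z := ⟨Z, ⟨a, hZ₁⟩, ⟨a + n, hZ₂⟩⟩) m g h hT
    have : IsIso g' := (Triangle.isZero₁_iff_isIso₂ _ hT').1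
      (isZero_singularityQuotient_obj (perfectComplexes_singleFunctor P _))
    exact Q.prop_of_iso (asIso g').symm (ih _ hZ₁ hZ₂)

/-- A class of objects of the singularity category that is closed under isomorphisms and shifts
and contains all modules is everything. -/
theorem eq_top_of_forall_singularitySingle (Q : ObjectProperty (SingularityCategory A))
    [Q.IsClosedUnderIsomorphisms] [Q.IsStableUnderShift ℤ]
    (hQ : ∀ M, Q ((singularitySingle A).obj M)) : Q = ⊤ := by
  have := Localization.essSurj (singularityQuotient A) (perf A).trW
  refine eq_top_iff.2 fun Y _ => ?_
  refine Q.prop_of_iso ((singularityQuotient A).objObjPreimageIso Y) ?_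
  generalize (singularityQuotient A).objPreimage Y = X
  obtain ⟨⟨a, ha⟩, ⟨b, hb⟩⟩ := X.property
  refine singularityQuotient_of_isGE_of_isLE Q hQ a (b - a).toNat X ha ?_
  -- If `b < a`, then `toNat` gives `0`; in every case `b ≤ a + (b - a).toNat`.
  exact TStructure.t.isLE_of_le X.obj b _ (by lia)

/-! ### Counting extensions. -/

theorem triangEnvelopeIter_zero_of_isInAdd {U M : FGModuleCat.{u} A} (h : IsInAdd A U M) :
    (ObjectProperty.singleton ((singularitySingle A).obj U)).triangEnvelopeIter 0
      ((singularitySingle A).obj M) := by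
  obtain ⟨n, i, r, hir⟩ := h
  let a (j : Fin n) : M ⟶ U := ObjectProperty.homMk (ModuleCat.ofHom (LinearMap.proj j ∘ₗ i))
  let b (j : Fin n) : U ⟶ M :=
    ObjectProperty.homMk (ModuleCat.ofHom (r ∘ₗ LinearMap.single A (fun _ => U) j))
  -- Written in components, the splitting is a sum of maps through `U`, a form that additive
  -- functors preserve.
  have hab : ∑ j, a j ≫ b j = 𝟙 M := by
    have hsum : (∑ j, a j ≫ b j).hom.hom = ∑ j, (a j ≫ b j).hom.hom :=
      map_sum (AddMonoidHom.mk' (fun f : M ⟶ M => f.hom.hom) fun _ _ => rfl) _ _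
    refine FGModuleCat.hom_ext (hsum.trans (LinearMap.ext fun x => ?_))
    rw [LinearMap.sum_apply]
    change ∑ j, r (Pi.single j (i x j)) = x
    rw [← map_sum, Finset.univ_sum_single]
    exact LinearMap.congr_fun hir x
  rw [ObjectProperty.triangEnvelopeIter_zero]
  refine ObjectProperty.prop_of_sum_comp_eq_id _ (Y := (singularitySingle A).obj U) ?_
    (fun j => (singularitySingle A).map (a j)) (fun j => (singularitySingle A).map (b j)) ?_
  · rw [← ObjectProperty.triangEnvelopeIter_zero]
    exact ObjectProperty.le_triangEnvelopeIter _ 0 _ (by simp)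
  · simp only [← Functor.map_comp, ← Functor.map_sum, hab]
    exact CategoryTheory.Functor.map_id _ _

theorem triangEnvelopeIter_of_hasAddResolution {U : FGModuleCat.{u} A} {m : ℕ}
    {X : FGModuleCat.{u} A} (h : HasAddResolution A U m X) :
    (ObjectProperty.singleton ((singularitySingle A).obj U)).triangEnvelopeIter m
      ((singularitySingle A).obj X) := by
  induction m generalizing X with
  | zero =>
    obtain ⟨V, d, ε, hV, hV', hε, h₀, hd⟩ := h
    -- As `V 1` is zero, exactness at `V 0` makes `ε` injective, hence an isomorphism.
    have := hV' 1 (by lia)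
    have hinj : Function.Injective ε := by
      rw [injective_iff_map_eq_zero]
      intro x hx
      obtain ⟨y, rfl⟩ := (h₀ x).1 hx
      rw [Subsingleton.elim y 0, map_zero]
    exact ObjectProperty.prop_of_iso _ ((singularitySingle A).mapIso
      (LinearEquiv.ofBijective ε ⟨hinj, hε⟩).toFGModuleCatIso)
      (triangEnvelopeIter_zero_of_isInAdd (hV 0 le_rfl))
  | succ m ih =>
    obtain ⟨V, d, ε, hV, hV', hε, h₀, hd⟩ := h
    have hker : ∀ x, d 0 x ∈ LinearMap.ker ε := fun x => (h₀ _).2 ⟨x, rfl⟩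
    -- Dropping `V 0` leaves a resolution of `ker ε` that is one term shorter.
    have hK : HasAddResolution A U m (FGModuleCat.of A (LinearMap.ker ε)) := by
      refine ⟨fun i => V (i + 1), fun i => d (i + 1), (d 0).codRestrict _ hker,
        fun i hi => hV _ (by lia), fun i hi => hV' _ (by lia), ?_, ?_, fun i => hd _⟩
      · rintro ⟨x, hx⟩
        obtain ⟨y, rfl⟩ := (h₀ x).1 hx
        exact ⟨y, rfl⟩
      · intro x
        exact Subtype.ext_iff.trans (hd 0 x)
    obtain ⟨f', g', h', hT⟩ := exists_distTriang_singularitySingle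
      (X := FGModuleCat.of A (LinearMap.ker ε)) (LinearMap.ker ε).subtype ε
      (Submodule.injective_subtype _) hε (LinearMap.exact_subtype_ker_map ε)
    -- Rotation puts `X` in the middle, as an extension of `(ker ε)⟦1⟧` by `V 0`; the shift costs
    -- nothing.
    rw [ObjectProperty.triangEnvelopeIter_succ]
    refine ObjectProperty.le_retractClosure _ _
      ⟨_, _, _, _, _, rot_of_distTriang _ hT, ?_, ObjectProperty.le_shift _ 1 _ (ih hK)⟩
    rw [← ObjectProperty.triangEnvelopeIter_zero]
    exact triangEnvelopeIter_zero_of_isInAdd (hV 0 (by lia))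

theorem rouquierDim_singularityCategory_le (A : Type u) [Ring A] [IsNoetherianRing A] :
    rouquierDim (SingularityCategory A) ≤ igusaTodorovDist A := by
  refine le_sInf ?_
  rintro _ ⟨m, n, ⟨U, hU⟩, rfl⟩
  refine sInf_le ⟨m, ⟨(singularitySingle A).obj U, ?_⟩, rfl⟩
  refine eq_top_of_forall_singularitySingle _ fun M => ?_
  obtain ⟨K, hK, hres⟩ := hU M
  exact singularitySingle_of_isSyzygy _ hK (triangEnvelopeIter_of_hasAddResolution hres)

end SingularityCategory

theorem theorem1p2 (k : Type w) (A : Type u) [CommRing k] [IsArtinianRing k] [Ring A]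
    [Algebra k A] [Module.Finite k A] :
    haveI : IsNoetherianRing A := isNoetherianRing_of_artinAlgebra k A
    rouquierDim (SingularityCategory A) ≤ igusaTodorovDist A :=
  haveI : IsNoetherianRing A := isNoetherianRing_of_artinAlgebra k A
  rouquierDim_singularityCategory_le A
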